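/- Let $\mathcal G=(\mathcal V,\mathcal E,\mathcal W)$ be a finite simple undirected graph with a weight function $\mathcal W:\mathcal E\to\mathbb R\setminus\{0\}$. Let $E$ be its incidence matrix (for any orientation of the edges), $W$ the diagonal matrix of the edge weights, and $L(\mathcal G)=EWE^T$ its weighted Laplacian. Let $\mathcal E_+$ and $\mathcal E_-$ be the sets of edges with positive and negative weight, and let $\mathcal G_+=(\mathcal V,\mathcal E_+,\mathcal W|_{\mathcal E_+})$. For nodes $u,v\in\mathcal V$ let $$\mathcal R_{uv}(\mathcal G_+)=(\mathbf e_u-\mathbf e_v)^T L(\mathcal G_+)^\dagger(\mathbf e_u-\mathbf e_v)$$ be the effective resistance between $u$ and $v$ in $\mathcal G_+$, where $\dagger$ denotes the Moore–Penrose pseudo-inverse and $\mathbf e_u$ the indicator vector of $u$. For $k=\{u,v\}\in\mathcal E_-$ write $\mathcal R_k(\mathcal G_+)=\mathcal R_{uv}(\mathcal G_+)$, and let $P_k\subseteq\mathcal E_+$ be the set of all edges that lie on some simple path in $\mathcal G_+$ from $u$ to $v$. Let $\mathbf R=\mathrm{diag}(\mathcal R_k(\mathcal G_+))_{k\in\mathcal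 E_-}$ and $|W_-|=\mathrm{diag}(|\mathcal W(k)|)_{k\in\mathcal E_-}$. Theorem. Assume that $\mathcal G_+$ is connected, that $|\mathcal E_-|>1$, and that $P_i\cap P_j=\emptyset$ for all distinct $i,j\in\mathcal E_-$. Then $\mathbf R$ is invertible, and $L(\mathcal G)$ is positive semidefinite if and only if $|W_-|\le\mathbf R^{-1}$, that is, if and only if the diagonal matrix $\mathbf R^{-1}-|W_-|$ is positive semidefinite (equivalently, $|\mathcal W(k)|\le\mathcal R_k(\mathcal G_+)^{-1}$ for every $k\in\mathcal E_-$). -/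

import Mathlib

/-- An undirected weighted graph `(V, E, w)` with nonzero real edge weights of either sign. -/
structure WeightedGraph (V : Type*) where
  graph : SimpleGraph V
  weight : graph.edgeSet → ℝ
  weight_ne_zero : ∀ e, weight e ≠ 0

/-- `X` satisfies the four Penrose equations for the real matrix `A`. -/
structure IsMoorePenroseInverse {m n : Type*} [Fintype m] [Fintype n]
    (A : Matrix m n ℝ) (X : Matrix n m ℝ) : Prop where
  mul_mul_self : A * X * A = A
  mul_self_mul : X * A * X = X
  left_symm : (A * X).transpose = A * X
  right_symm : (X * A).transpose = X * A

theorem IsMoorePenroseInverse.unique {m n : Type*} [Fintype m] [Fintype n]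
    {A : Matrix m n ℝ} {X Y : Matrix n m ℝ}
    (hX : IsMoorePenroseInverse A X) (hY : IsMoorePenroseInverse A Y) : X = Y := by
  have h1 : A * X = A * Y := by
    calc A * X = (A * X).transpose := hX.left_symm.symm
      _ = ((A * Y) * (A * X)).transpose := by
          rw [← Matrix.mul_assoc, hY.mul_mul_self]
      _ = (A * X) * (A * Y) := by
          rw [Matrix.transpose_mul, hX.left_symm, hY.left_symm]
      _ = A * Y := by rw [← Matrix.mul_assoc, hX.mul_mul_self]
  have h2 : X * A = Y * A := by
    calc X * A = (X * A).transpose := hX.right_symm.symm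
      _ = ((X * A) * (Y * A)).transpose := by
          rw [Matrix.mul_assoc X A, ← Matrix.mul_assoc A Y A, hY.mul_mul_self]
      _ = (Y * A) * (X * A) := by
          rw [Matrix.transpose_mul, hX.right_symm, hY.right_symm]
      _ = Y * A := by
          rw [Matrix.mul_assoc Y A, ← Matrix.mul_assoc A X A, hX.mul_mul_self]
  calc X = X * A * X := hX.mul_self_mul.symm
    _ = Y * A * Y := by rw [h2, Matrix.mul_assoc, h1, ← Matrix.mul_assoc]
    _ = Y := hY.mul_self_mul

open Classical in
theorem exists_isMoorePenroseInverse {n : Type*} [Fintype n]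
    (A : Matrix n n ℝ) (hA : A.IsSymm) : ∃ X, IsMoorePenroseInverse A X := by
  have hH : A.IsHermitian := by
    rw [Matrix.IsHermitian, Matrix.conjTranspose_eq_transpose_of_trivial]; exact hA
  obtain ⟨U, hU, D, hD⟩ : ∃ U : Matrix n n ℝ, U.transpose * U = 1 ∧
      ∃ D : n → ℝ, A = U * Matrix.diagonal D * U.transpose := by
    refine ⟨hH.eigenvectorUnitary, ?_, hH.eigenvalues, ?_⟩
    · have := Unitary.coe_star_mul_self hH.eigenvectorUnitary
      simpa [Matrix.star_eq_conjTranspose] using this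
    · have := hH.spectral_theorem
      simpa [Unitary.conjStarAlgAut_apply, Matrix.star_eq_conjTranspose, Function.comp_def]
        using this
  have key : ∀ M N : Matrix n n ℝ,
      (U * M * U.transpose) * (U * N * U.transpose) = U * (M * N) * U.transpose := by
    intro M N
    calc (U * M * U.transpose) * (U * N * U.transpose)
        = U * M * (U.transpose * U) * N * U.transpose := by simp only [Matrix.mul_assoc]
      _ = _ := by rw [hU]; simp only [Matrix.mul_assoc, Matrix.one_mul]
  refine ⟨U * Matrix.diagonal (fun i => (D i)⁻¹) * U.transpose, ?_, ?_, ?_, ?_⟩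
  · rw [hD, key, key]; simp
  · rw [hD, key, key]
    simp only [Matrix.diagonal_mul_diagonal]
    congr 3
    funext i
    by_cases h : D i = 0 <;> simp [h]
  · rw [hD, key]; simp [Matrix.mul_assoc]
  · rw [hD, key]; simp [Matrix.mul_assoc]

/-- The Moore-Penrose pseudo-inverse of a real symmetric matrix. -/
noncomputable def symmPseudoInverse {n : Type*} [Fintype n]
    (A : Matrix n n ℝ) (hA : A.IsSymm) : Matrix n n ℝ :=
  (exists_isMoorePenroseInverse A hA).choose

namespace WeightedGraph

variable {V : Type*}

/-- The edges of `G`. -/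
abbrev Edge (G : WeightedGraph V) : Type _ := G.graph.edgeSet

/-- The edges of `G` with negative weight. -/
abbrev NegEdge (G : WeightedGraph V) : Type _ := {e : G.Edge // G.weight e < 0}

noncomputable instance instFintypeEdge [Fintype V] (G : WeightedGraph V) : Fintype G.Edge :=
  Fintype.ofFinite _

noncomputable instance instFintypeNegEdge [Fintype V] (G : WeightedGraph V) :
    Fintype G.NegEdge :=
  Fintype.ofFinite _

noncomputable instance instDecidableEqEdge (G : WeightedGraph V) : DecidableEq G.Edge :=
  Classical.decEq _

/-- The subgraph of `G` on the same node set whose edges are those of positive weight. -/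
def posPart (G : WeightedGraph V) : WeightedGraph V where
  graph :=
    { Adj := fun u v => ∃ h : s(u, v) ∈ G.graph.edgeSet, 0 < G.weight ⟨s(u, v), h⟩
      symm := by
        constructor
        rintro u v h
        rw [Sym2.eq_swap]
        exact h
      loopless := by
        constructor
        rintro u ⟨h, -⟩
        exact G.graph.loopless.irrefl u h }
  weight := fun e => G.weight ⟨e.1, by
    obtain ⟨e, he⟩ := e
    induction e with
    | _ u v => exact he.1⟩
  weight_ne_zero := fun _ => G.weight_ne_zero _

open Classical in
/-- The incidence matrix, each edge being given the (arbitrary but fixed) orientation from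
`e.1.out.1` to `e.1.out.2`. -/
noncomputable def incidenceMatrix (G : WeightedGraph V) : Matrix V G.Edge ℝ :=
  fun v e => (if v = (Quot.out e.1).1 then 1 else 0) - (if v = (Quot.out e.1).2 then 1 else 0)

/-- The weighted Laplacian `E W Eᵀ`. -/
noncomputable def laplacian [Fintype V] (G : WeightedGraph V) : Matrix V V ℝ :=
  G.incidenceMatrix * Matrix.diagonal G.weight * G.incidenceMatrix.transpose

theorem laplacian_isSymm [Fintype V] (G : WeightedGraph V) : G.laplacian.IsSymm := by
  simp [Matrix.IsSymm, laplacian, Matrix.mul_assoc]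

open Classical in
/-- The effective resistance `(e_u - e_v)ᵀ L† (e_u - e_v)`. -/
noncomputable def effectiveResistance [Fintype V] (G : WeightedGraph V) (u v : V) : ℝ :=
  (Pi.single u 1 - Pi.single v 1 : V → ℝ) ⬝ᵥ
    (symmPseudoInverse G.laplacian G.laplacian_isSymm).mulVec (Pi.single u 1 - Pi.single v 1)

open Classical in
theorem effectiveResistance_comm [Fintype V] (G : WeightedGraph V) (u v : V) :
    G.effectiveResistance u v = G.effectiveResistance v u := by
  unfold effectiveResistance
  rw [← neg_sub (Pi.single v 1 : V → ℝ) (Pi.single u 1), Matrix.mulVec_neg, neg_dotProduct_neg]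

/-- The effective resistance between the endpoints of an (unordered) pair of nodes. -/
noncomputable def pairResistance [Fintype V] (G : WeightedGraph V) (k : Sym2 V) : ℝ :=
  Sym2.lift ⟨G.effectiveResistance, G.effectiveResistance_comm⟩ k

/-- The diagonal matrix of the effective resistances over the positive part of `G` between the
endpoints of the negative edges of `G`. -/
noncomputable def resistanceMatrix [Fintype V] (G : WeightedGraph V) :
    Matrix G.NegEdge G.NegEdge ℝ :=
  Matrix.diagonal fun k => G.posPart.pairResistance k.1.1

/-- The diagonal matrix of the absolute values of the negative weights. -/
noncomputable def absNegWeightMatrix (G : WeightedGraph V) : Matrix G.NegEdge G.NegEdge ℝ :=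
  Matrix.diagonal fun k => |G.weight k.1|

/-- The edges of the positive part of `G` that lie on some (simple) path in the positive part
joining the endpoints of the negative edge `k`. -/
def pathEdges (G : WeightedGraph V) (k : G.NegEdge) : Set (Sym2 V) :=
  {e | ∃ u v : V, k.1.1 = s(u, v) ∧ ∃ p : G.posPart.graph.Walk u v, p.IsPath ∧ e ∈ p.edges}

end WeightedGraph

/-!
Read `G₊ = G.posPart` as an electrical network with conductances `w`, so that `xᵀ L(G₊) x` is the
power dissipated by the potential `x`, and let `z` be the potential of a unit current from `u` to
`v`.

Away from `u`, Kirchhoff's law forbids a node with a lower neighbour but no higher one, and dually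
away from `v`. Hence, from an edge carrying current, one can climb to `u` and descend to `v`; the
two halves are separated by their potentials, so the edge lies on a simple path from `u` to `v`.
Consequently `x u - x v = zᵀ L(G₊) x` only involves the edges on such paths, and Cauchy–Schwarz
gives `(x u - x v)² ≤ R_uv ∑ w (dx)²`, the sum being over those edges. When the path sets of the
negative edges are disjoint, these bounds add up to `∑ₖ (dx)ₖ² / Rₖ ≤ xᵀ L(G₊) x`, so
`|wₖ| ≤ 1 / Rₖ` makes `L(G)` positive semidefinite. Conversely, testing `L(G)` on `z` for the ends
of the negative edge `k` gives `0 ≤ Rₖ - |wₖ| Rₖ²`.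
-/

open Matrix Function

theorem isMoorePenroseInverse_symmPseudoInverse {n : Type*} [Fintype n]
    (A : Matrix n n ℝ) (hA : A.IsSymm) : IsMoorePenroseInverse A (symmPseudoInverse A hA) :=
  (exists_isMoorePenroseInverse A hA).choose_spec

theorem IsMoorePenroseInverse.mulVec_mulVec_eq_self {m n : Type*} [Fintype m] [Fintype n]
    {A : Matrix m n ℝ} {X : Matrix n m ℝ} (hX : IsMoorePenroseInverse A X) {b : m → ℝ}
    (hb : ∀ y, y ᵥ* A = 0 → y ⬝ᵥ b = 0) : A *ᵥ (X *ᵥ b) = b := by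
  set r := b - A *ᵥ (X *ᵥ b) with hr
  have hrA : r ᵥ* A = 0 := by
    rw [hr, mulVec_mulVec, ← hX.left_symm, mulVec_transpose, sub_vecMul, vecMul_vecMul,
      hX.mul_mul_self, sub_self]
  have hrr : r ⬝ᵥ r = 0 := by
    nth_rw 2 [hr]
    rw [dotProduct_sub, hb r hrA, dotProduct_mulVec, hrA, zero_dotProduct, sub_zero]
  exact (sub_eq_zero.1 (dotProduct_self_eq_zero.1 hrr)).symm

section MonotonePaths

variable {V α : Type*} [Finite V] {H : SimpleGraph V} {u v a b : V}

theorem exists_isPath_forall_le_of_exists_adj_lt [Preorder α] {x : V → α}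
    (hx : ∀ a ≠ u, ∀ b, H.Adj a b → x b < x a → ∃ c, H.Adj a c ∧ x a < x c)
    (hab : H.Adj a b) (hlt : x b < x a) :
    ∃ p : H.Walk u a, p.IsPath ∧ ∀ c ∈ p.support, x a ≤ x c := by
  let : Preorder V := Preorder.lift x
  induction a using WellFoundedGT.induction generalizing b with
  | _ a ih =>
    by_cases hau : a = u
    · subst hau
      exact ⟨.nil, by simp, by simp⟩
    · obtain ⟨c, hac, hc⟩ := hx a hau b hab hlt
      obtain ⟨p, hp, hle⟩ := ih c hc hac.symm hc
      refine ⟨p.concat hac.symm, hp.concat (fun ha => (hle a ha).not_gt hc) _, fun d hd => ?_⟩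
      rw [SimpleGraph.Walk.support_concat, List.mem_append, List.mem_singleton] at hd
      rcases hd with hd | rfl
      · exact hc.le.trans (hle d hd)
      · exact le_rfl

theorem exists_isPath_mem_edges_of_lt [Preorder α] {x : V → α}
    (hu : ∀ a ≠ u, ∀ b, H.Adj a b → x b < x a → ∃ c, H.Adj a c ∧ x a < x c)
    (hv : ∀ a ≠ v, ∀ b, H.Adj a b → x a < x b → ∃ c, H.Adj a c ∧ x c < x a)
    (hab : H.Adj a b) (hlt : x b < x a) :
    ∃ p : H.Walk u v, p.IsPath ∧ s(a, b) ∈ p.edges := by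
  obtain ⟨p, hp, hpa⟩ := exists_isPath_forall_le_of_exists_adj_lt hu hab hlt
  obtain ⟨q, hq, hqb⟩ :=
    exists_isPath_forall_le_of_exists_adj_lt (x := OrderDual.toDual ∘ x) hv hab.symm hlt
  refine ⟨p.append (.cons hab q.reverse), .mk' ?_, by simp⟩
  rw [SimpleGraph.Walk.support_append, SimpleGraph.Walk.support_cons, List.tail_cons,
    List.nodup_append']
  refine ⟨hp.support_nodup, hq.reverse.support_nodup, fun c hcp hcq => ?_⟩
  rw [SimpleGraph.Walk.support_reverse, List.mem_reverse] at hcq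
  have hcb : x c ≤ x b := hqb c hcq
  exact ((hpa c hcp).trans hcb).not_gt hlt

end MonotonePaths

namespace WeightedGraph

variable {V : Type*}

/-- The product of the increments of `x` and `y` along a pair of nodes, which does not depend on
the orientation of the pair. The Laplacian form is its weighted sum over the edges. -/
def incrMul (x y : V → ℝ) : Sym2 V → ℝ :=
  Sym2.lift ⟨fun a b => (x a - x b) * (y a - y b), fun a b => by ring⟩

@[simp]
theorem incrMul_mk (x y : V → ℝ) (a b : V) : incrMul x y s(a, b) = (x a - x b) * (y a - y b) :=
  rfl

theorem incrMul_self_nonneg (x : V → ℝ) (e : Sym2 V) : 0 ≤ incrMul x x e := by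
  induction e with
  | _ a b => exact mul_self_nonneg _

theorem incrMul_sq (x y : V → ℝ) (e : Sym2 V) :
    incrMul x y e ^ 2 = incrMul x x e * incrMul y y e := by
  induction e with
  | _ a b => simp only [incrMul_mk]; ring

theorem incrMul_single_nonneg [DecidableEq V] {x : V → ℝ} {a : V} {e : Sym2 V}
    (h : ∀ c, e = s(a, c) → x c ≤ x a) : 0 ≤ incrMul (Pi.single a 1) x e := by
  by_cases ha : a ∈ e
  · obtain ⟨c, rfl⟩ := ha
    by_cases hca : c = a
    · simp [hca]
    · simpa [hca] using h c rfl
  · induction e with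
    | _ p q =>
      rw [Sym2.mem_iff, not_or] at ha
      simp [Ne.symm ha.1, Ne.symm ha.2]

theorem weight_mul_incrMul_self_nonneg {H : WeightedGraph V} (hH : ∀ e, 0 < H.weight e)
    (x : V → ℝ) (e : H.Edge) : 0 ≤ H.weight e * incrMul x x e :=
  mul_nonneg (hH e).le (incrMul_self_nonneg x e)

theorem dotProduct_laplacian_mulVec [Fintype V] (G : WeightedGraph V) (x y : V → ℝ) :
    x ⬝ᵥ G.laplacian *ᵥ y = ∑ e : G.Edge, G.weight e * incrMul x y e := by
  classical
  have vecMul_incidenceMatrix (z : V → ℝ) :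
      z ᵥ* G.incidenceMatrix = fun e => z (Quot.out e.1).1 - z (Quot.out e.1).2 := by
    ext e
    simp [vecMul, dotProduct, incidenceMatrix, mul_sub]
  rw [laplacian, ← mulVec_mulVec, ← mulVec_mulVec, dotProduct_mulVec, mulVec_transpose,
    vecMul_incidenceMatrix, vecMul_incidenceMatrix]
  simp only [dotProduct, mulVec_diagonal]
  refine Finset.sum_congr rfl fun e _ => ?_
  conv_rhs => rw [← Quot.out_eq e.1]
  exact mul_left_comm _ _ _

theorem posSemidef_laplacian_iff [Fintype V] (G : WeightedGraph V) :
    G.laplacian.PosSemidef ↔ ∀ x : V → ℝ, 0 ≤ x ⬝ᵥ G.laplacian *ᵥ x := by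
  rw [posSemidef_iff_dotProduct_mulVec, IsHermitian, conjTranspose_eq_transpose_of_trivial]
  simp only [star_trivial, and_iff_right_iff_imp]
  exact fun _ => G.laplacian_isSymm

open Classical in
/-- The current source `e_u - e_v` injecting one unit at `u` and extracting it at `v`. -/
noncomputable def dipole (u v : V) : V → ℝ :=
  Pi.single u 1 - Pi.single v 1

theorem dotProduct_dipole [Fintype V] (x : V → ℝ) (u v : V) : x ⬝ᵥ dipole u v = x u - x v := by
  simp [dipole, dotProduct_sub]

theorem dipole_nonpos {u v a : V} (ha : a ≠ u) : dipole u v a ≤ 0 := by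
  simp only [dipole, Pi.sub_apply, Pi.single_apply, if_neg ha]
  split_ifs <;> norm_num

theorem dipole_nonneg {u v a : V} (ha : a ≠ v) : 0 ≤ dipole u v a := by
  simp only [dipole, Pi.sub_apply, Pi.single_apply, if_neg ha]
  split_ifs <;> norm_num

/-- The potential `L† (e_u - e_v)` induced by a unit current from `u` to `v`. -/
noncomputable def potential [Fintype V] (H : WeightedGraph V) (u v : V) : V → ℝ :=
  symmPseudoInverse H.laplacian H.laplacian_isSymm *ᵥ dipole u v

theorem potential_sub_potential_eq_effectiveResistance [Fintype V] (H : WeightedGraph V) (u v : V) :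
    H.potential u v u - H.potential u v v = H.effectiveResistance u v := by
  rw [← dotProduct_dipole, dotProduct_comm]
  rfl

section PositiveWeights

variable [Fintype V] {H : WeightedGraph V} (hH : ∀ e, 0 < H.weight e) {x : V → ℝ} {u v a b : V}
include hH

theorem eq_of_dotProduct_laplacian_mulVec_self_eq_zero
    (hx : x ⬝ᵥ H.laplacian *ᵥ x = 0) (hab : H.graph.Reachable a b) : x a = x b := by
  rw [dotProduct_laplacian_mulVec, Finset.sum_eq_zero_iff_of_nonneg
    fun e _ => weight_mul_incrMul_self_nonneg hH x e] at hx
  obtain ⟨p⟩ := hab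
  induction p with
  | nil => rfl
  | @cons c d _ hcd _ ih =>
    have hzero := hx ⟨s(c, d), hcd⟩ (Finset.mem_univ _)
    rw [mul_eq_zero_iff_left (hH _).ne', incrMul_mk, mul_self_eq_zero, sub_eq_zero] at hzero
    exact hzero.trans ih

theorem laplacian_mulVec_potential (huv : H.graph.Reachable u v) :
    H.laplacian *ᵥ H.potential u v = dipole u v := by
  refine (isMoorePenroseInverse_symmPseudoInverse _ _).mulVec_mulVec_eq_self fun y hy => ?_
  rw [dotProduct_dipole, sub_eq_zero]
  refine eq_of_dotProduct_laplacian_mulVec_self_eq_zero hH ?_ huv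
  rw [dotProduct_mulVec, hy, zero_dotProduct]

theorem dotProduct_laplacian_mulVec_potential (huv : H.graph.Reachable u v) (x : V → ℝ) :
    x ⬝ᵥ H.laplacian *ᵥ H.potential u v = x u - x v := by
  rw [laplacian_mulVec_potential hH huv, dotProduct_dipole]

theorem exists_adj_lt_of_laplacian_mulVec_nonpos (hx : (H.laplacian *ᵥ x) a ≤ 0)
    (hab : H.graph.Adj a b) (hlt : x b < x a) : ∃ c, H.graph.Adj a c ∧ x a < x c := by
  classical
  by_contra! hle
  have hsum : (H.laplacian *ᵥ x) a = ∑ e : H.Edge, H.weight e * incrMul (Pi.single a 1) x e := by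
    rw [← dotProduct_laplacian_mulVec, single_dotProduct, one_mul]
  refine hx.not_gt (hsum ▸ Finset.sum_pos' (fun e _ => mul_nonneg (hH e).le ?_)
    ⟨⟨s(a, b), hab⟩, Finset.mem_univ _, mul_pos (hH _) ?_⟩)
  · exact incrMul_single_nonneg fun c hc => hle c (by simpa [hc] using e.2)
  · simpa [hab.ne'] using hlt

theorem exists_adj_lt_of_laplacian_mulVec_nonneg (hx : 0 ≤ (H.laplacian *ᵥ x) a)
    (hab : H.graph.Adj a b) (hlt : x a < x b) : ∃ c, H.graph.Adj a c ∧ x c < x a := by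
  have hneg : (H.laplacian *ᵥ (-x)) a ≤ 0 := by simpa [mulVec_neg] using hx
  simpa using exists_adj_lt_of_laplacian_mulVec_nonpos hH hneg hab (by simpa using hlt)

theorem exists_isPath_mem_edges_of_laplacian_mulVec_eq_dipole
    (hx : H.laplacian *ᵥ x = dipole u v) (hab : H.graph.Adj a b) (hne : x a ≠ x b) :
    ∃ p : H.graph.Walk u v, p.IsPath ∧ s(a, b) ∈ p.edges := by
  have climb : ∀ a ≠ u, ∀ b, H.graph.Adj a b → x b < x a → ∃ c, H.graph.Adj a c ∧ x a < x c :=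
    fun a ha _ => exists_adj_lt_of_laplacian_mulVec_nonpos hH (hx ▸ dipole_nonpos ha)
  have descend : ∀ a ≠ v, ∀ b, H.graph.Adj a b → x a < x b → ∃ c, H.graph.Adj a c ∧ x c < x a :=
    fun a ha _ => exists_adj_lt_of_laplacian_mulVec_nonneg hH (hx ▸ dipole_nonneg ha)
  rcases hne.lt_or_gt with hlt | hlt
  · rw [Sym2.eq_swap]
    exact exists_isPath_mem_edges_of_lt climb descend hab.symm hlt
  · exact exists_isPath_mem_edges_of_lt climb descend hab hlt

/-- A form of Dirichlet's principle in which the energy is only counted on `S`. -/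
theorem sub_sq_le_effectiveResistance_mul_sum (huv : H.graph.Reachable u v) {S : Finset H.Edge}
    (hS : ∀ p : H.graph.Walk u v, p.IsPath → ∀ e : H.Edge, e.1 ∈ p.edges → e ∈ S) (x : V → ℝ) :
    (x u - x v) ^ 2 ≤ H.effectiveResistance u v * ∑ e ∈ S, H.weight e * incrMul x x e := by
  set z := H.potential u v
  have hoff : ∀ e ∉ S, ∀ y, incrMul y z e = 0 := by
    rintro ⟨e, he⟩ heS y
    induction e with
    | _ a b =>
      suffices hz : z a = z b by simp [hz]
      by_contra hne
      obtain ⟨p, hp, hmem⟩ := exists_isPath_mem_edges_of_laplacian_mulVec_eq_dipole hH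
        (laplacian_mulVec_potential hH huv) he hne
      exact heS (hS p hp _ hmem)
  have hflow : ∀ y, ∑ e ∈ S, H.weight e * incrMul y z e = y u - y v := fun y => by
    rw [← dotProduct_laplacian_mulVec_potential hH huv, dotProduct_laplacian_mulVec]
    exact Finset.sum_subset S.subset_univ fun e _ he => by rw [hoff e he, mul_zero]
  calc (x u - x v) ^ 2
      = (∑ e ∈ S, H.weight e * incrMul x z e) ^ 2 := by rw [hflow]
    _ ≤ (∑ e ∈ S, H.weight e * incrMul z z e) * ∑ e ∈ S, H.weight e * incrMul x x e :=
        Finset.sum_sq_le_sum_mul_sum_of_sq_le_mul S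
          (fun e _ => weight_mul_incrMul_self_nonneg hH z e)
          (fun e _ => weight_mul_incrMul_self_nonneg hH x e)
          fun e _ => by rw [mul_pow, incrMul_sq]; exact le_of_eq (by ring)
    _ = H.effectiveResistance u v * ∑ e ∈ S, H.weight e * incrMul x x e := by
        rw [hflow, potential_sub_potential_eq_effectiveResistance]

theorem effectiveResistance_pos (huv : H.graph.Reachable u v) (hne : u ≠ v) :
    0 < H.effectiveResistance u v := by
  classical
  have hle := sub_sq_le_effectiveResistance_mul_sum hH huv (S := Finset.univ)
    (fun _ _ e _ => Finset.mem_univ e) (Pi.single u 1)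
  refine pos_of_mul_pos_left (lt_of_lt_of_le ?_ hle)
    (Finset.sum_nonneg fun e _ => weight_mul_incrMul_self_nonneg hH _ e)
  simp [hne.symm]

end PositiveWeights

section NegativeEdges

variable {G : WeightedGraph V}

theorem mem_edgeSet_posPart {e : Sym2 V} :
    e ∈ G.posPart.graph.edgeSet ↔ ∃ h : e ∈ G.graph.edgeSet, 0 < G.weight ⟨e, h⟩ := by
  induction e with
  | _ u v => rfl

theorem posPart_weight_pos (e : G.posPart.Edge) : 0 < G.posPart.weight e :=
  (mem_edgeSet_posPart.1 e.2).2

theorem exists_adj_eq (k : G.NegEdge) : ∃ u v, G.graph.Adj u v ∧ k.1.1 = s(u, v) := by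
  obtain ⟨⟨e, he⟩, -⟩ := k
  induction e with
  | _ u v => exact ⟨u, v, he, rfl⟩

variable [Fintype V]

theorem dotProduct_laplacian_mulVec_eq_sub (x y : V → ℝ) :
    x ⬝ᵥ G.laplacian *ᵥ y = x ⬝ᵥ G.posPart.laplacian *ᵥ y -
      ∑ k : G.NegEdge, |G.weight k.1| * incrMul x y k.1 := by
  classical
  let posPartEdgeEquiv : G.posPart.Edge ≃ {e : G.Edge // ¬ G.weight e < 0} :=
    (Equiv.subtypeEquivRight fun _ => mem_edgeSet_posPart).trans <|
      (Equiv.subtypeSubtypeEquivSubtypeExists (· ∈ G.graph.edgeSet) (0 < G.weight ·)).symm.trans <|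
        Equiv.subtypeEquivRight fun e => by rw [not_lt, (G.weight_ne_zero e).symm.le_iff_lt]
  have hpos : ∑ e : G.posPart.Edge, G.posPart.weight e * incrMul x y e =
      ∑ e : {e : G.Edge // ¬ G.weight e < 0}, G.weight e.1 * incrMul x y e.1 :=
    Fintype.sum_equiv posPartEdgeEquiv _ _ fun _ => rfl
  have hneg : -∑ k : G.NegEdge, |G.weight k.1| * incrMul x y k.1 =
      ∑ k : G.NegEdge, G.weight k.1 * incrMul x y k.1 := by
    rw [← Finset.sum_neg_distrib]
    refine Finset.sum_congr rfl fun k _ => ?_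
    rw [abs_of_neg k.2, neg_mul, neg_neg]
  rw [dotProduct_laplacian_mulVec, dotProduct_laplacian_mulVec, hpos, sub_eq_add_neg, hneg,
    add_comm]
  convert (Fintype.sum_subtype_add_sum_subtype (fun e : G.Edge => G.weight e < 0)
    fun e => G.weight e * incrMul x y e).symm

variable (hreach : ∀ ⦃u v⦄, G.graph.Adj u v → G.posPart.graph.Reachable u v)
include hreach

theorem pairResistance_posPart_pos (k : G.NegEdge) : 0 < G.posPart.pairResistance k.1 := by
  obtain ⟨u, v, huv, hk⟩ := exists_adj_eq k
  rw [hk]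
  exact effectiveResistance_pos posPart_weight_pos (hreach huv) huv.ne

open Classical in
theorem incrMul_self_le_pairResistance_mul_sum_pathEdges (k : G.NegEdge) (x : V → ℝ) :
    incrMul x x k.1 ≤ G.posPart.pairResistance k.1 *
      ∑ e : G.posPart.Edge with e.1 ∈ G.pathEdges k, G.posPart.weight e * incrMul x x e := by
  obtain ⟨u, v, huv, hk⟩ := exists_adj_eq k
  rw [hk, incrMul_mk, ← sq]
  exact sub_sq_le_effectiveResistance_mul_sum posPart_weight_pos (hreach huv)
    (fun p hp e he => Finset.mem_filter.2 ⟨Finset.mem_univ e, u, v, hk, p, hp, he⟩) x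

theorem abs_weight_le_inv_pairResistance (hG : G.laplacian.PosSemidef) (k : G.NegEdge) :
    |G.weight k.1| ≤ (G.posPart.pairResistance k.1)⁻¹ := by
  have hR := pairResistance_posPart_pos hreach k
  obtain ⟨u, v, huv, hk⟩ := exists_adj_eq k
  set R := G.posPart.pairResistance k.1 with hRk
  set z := G.posPart.potential u v
  have hz : z u - z v = R := by
    rw [potential_sub_potential_eq_effectiveResistance, hRk, hk]
    rfl
  have henergy : z ⬝ᵥ G.posPart.laplacian *ᵥ z = R := by
    rw [dotProduct_laplacian_mulVec_potential posPart_weight_pos (hreach huv), hz]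
  have hterm : |G.weight k.1| * (R * R) ≤ ∑ i : G.NegEdge, |G.weight i.1| * incrMul z z i.1 := by
    have hincr : incrMul z z k.1 = R * R := by rw [hk, incrMul_mk, hz]
    rw [← hincr]
    exact Finset.single_le_sum (f := fun i : G.NegEdge => |G.weight i.1| * incrMul z z i.1)
      (fun i _ => mul_nonneg (abs_nonneg _) (incrMul_self_nonneg z _)) (Finset.mem_univ k)
  have hnonneg := G.posSemidef_laplacian_iff.1 hG z
  rw [dotProduct_laplacian_mulVec_eq_sub, henergy, sub_nonneg] at hnonneg
  rw [← one_div, le_div_iff₀ hR]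
  refine le_of_mul_le_mul_right ?_ hR
  linarith

variable (hdisj : Pairwise (Disjoint on G.pathEdges))
include hdisj

theorem sum_incrMul_self_div_pairResistance_le (x : V → ℝ) :
    ∑ k : G.NegEdge, (G.posPart.pairResistance k.1)⁻¹ * incrMul x x k.1 ≤
      x ⬝ᵥ G.posPart.laplacian *ᵥ x := by
  classical
  let S (k : G.NegEdge) : Finset G.posPart.Edge := {e | e.1 ∈ G.pathEdges k}
  have hS : Set.PairwiseDisjoint (Finset.univ : Finset G.NegEdge) S := fun i _ j _ hij =>
    Finset.disjoint_filter.2 fun _ _ hi hj => Set.disjoint_left.1 (hdisj hij) hi hj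
  calc ∑ k : G.NegEdge, (G.posPart.pairResistance k.1)⁻¹ * incrMul x x k.1
      ≤ ∑ k, ∑ e ∈ S k, G.posPart.weight e * incrMul x x e := Finset.sum_le_sum fun k _ =>
        (inv_mul_le_iff₀ (pairResistance_posPart_pos hreach k)).2
          (incrMul_self_le_pairResistance_mul_sum_pathEdges hreach k x)
    _ = ∑ e ∈ Finset.univ.biUnion S, G.posPart.weight e * incrMul x x e :=
        (Finset.sum_biUnion hS).symm
    _ ≤ ∑ e : G.posPart.Edge, G.posPart.weight e * incrMul x x e :=
        Finset.sum_le_sum_of_subset_of_nonneg (Finset.subset_univ _) fun e _ _ =>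
          weight_mul_incrMul_self_nonneg posPart_weight_pos x e
    _ = x ⬝ᵥ G.posPart.laplacian *ᵥ x := (dotProduct_laplacian_mulVec ..).symm

theorem posSemidef_laplacian_iff_forall_abs_weight_le :
    G.laplacian.PosSemidef ↔
      ∀ k : G.NegEdge, |G.weight k.1| ≤ (G.posPart.pairResistance k.1)⁻¹ := by
  refine ⟨abs_weight_le_inv_pairResistance hreach,
    fun h => G.posSemidef_laplacian_iff.2 fun x => ?_⟩
  rw [dotProduct_laplacian_mulVec_eq_sub, sub_nonneg]
  exact (Finset.sum_le_sum fun k _ => mul_le_mul_of_nonneg_right (h k)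
    (incrMul_self_nonneg x _)).trans (sum_incrMul_self_div_pairResistance_le hreach hdisj x)

end NegativeEdges

end WeightedGraph

open WeightedGraph

theorem mainTheorem2_general {V : Type*} [Fintype V] (G : WeightedGraph V)
    (hreach : ∀ ⦃u v⦄, G.graph.Adj u v → G.posPart.graph.Reachable u v)
    (hdisj : Pairwise (Disjoint on G.pathEdges)) :
    IsUnit G.resistanceMatrix ∧
      (G.laplacian.PosSemidef ↔
        (G.resistanceMatrix⁻¹ - G.absNegWeightMatrix).PosSemidef) := by
  have hmul : G.resistanceMatrix * diagonal (fun k => (G.posPart.pairResistance k.1)⁻¹) = 1 := by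
    rw [resistanceMatrix, diagonal_mul_diagonal, ← diagonal_one]
    exact congrArg diagonal
      (funext fun k => mul_inv_cancel₀ (pairResistance_posPart_pos hreach k).ne')
  refine ⟨.of_mul_eq_one _ hmul, ?_⟩
  rw [posSemidef_laplacian_iff_forall_abs_weight_le hreach hdisj, inv_eq_right_inv hmul,
    absNegWeightMatrix, diagonal_sub, posSemidef_diagonal_iff]
  exact forall_congr' fun k => sub_nonneg.symm

theorem mainTheorem2 {V : Type*} [Fintype V] (G : WeightedGraph V)
    (hconn : G.posPart.graph.Connected)
    (hneg : 1 < Fintype.card G.NegEdge)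
    (hdisj : ∀ i j : G.NegEdge, i ≠ j → Disjoint (G.pathEdges i) (G.pathEdges j)) :
    IsUnit G.resistanceMatrix ∧
      (G.laplacian.PosSemidef ↔
        (G.resistanceMatrix⁻¹ - G.absNegWeightMatrix).PosSemidef) :=
  mainTheorem2_general G (fun u v _ => hconn.preconnected u v) fun i j => hdisj i j
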